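/- Let $p,n,N\ge 1$ be natural numbers, let $L_1,\dots,L_N>0$ and $\alpha_1,\dots,\alpha_N\in[0,1]$. Call a family $X_1,\dots,X_N$ of $n\times n$ (real or complex) random matrices, defined on some probability space, admissible if $X_1,\dots,X_N$ are independent and, for every $k$, $X_k$ is almost surely positive semidefinite, $\|X_k\|\le L_k$ almost surely, and $\|\mathbb{E}X_k\|=\alpha_kL_k$, where $\|\cdot\|$ is the operator norm induced by the Euclidean norm. Independent random matrices $Z_1,\dots,Z_N$ with $\mathbb{P}(Z_k=L_kI)=\alpha_k$ and $\mathbb{P}(Z_k=0)=1-\alpha_k$ for all $k$ exist, every such family is admissible, and it maximizes \[\mathbb{E}\,\mathrm{tr}\Big(\Big(\sum_{k=1}^{N}X_k\Big)^{p}\Big)\] among all admissible families, where $\mathrm{tr}$ is the (unnormalized) trace. The maximum equals $n\,\mathbb{E}\big[(f_1+\dots+f_N)^p\big]$, where $f_1,\dots,f_N$ are independent real random variables with $\mathbb{P}(f_k=L_k)=\alpha_k$ and $\mathbb{P}(f_k=0)=1-\alpha_k$. -/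

import Mathlib

open scoped Matrix.Norms.L2Operator ComplexOrder

universe u v w

/-- Matrices carry the product σ-algebra of their entries. -/
instance matrixMeasurableSpace {m n R : Type*} [MeasurableSpace R] :
    MeasurableSpace (Matrix m n R) :=
  inferInstanceAs (MeasurableSpace (m → n → R))

/-- The entrywise expectation of a random matrix. -/
noncomputable def matrixExpectation {𝕜 : Type*} [RCLike 𝕜] {n : ℕ} {Ω : Type*} [MeasurableSpace Ω]
    (μ : MeasureTheory.Measure Ω) (X : Ω → Matrix (Fin n) (Fin n) 𝕜) :
    Matrix (Fin n) (Fin n) 𝕜 :=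
  Matrix.of fun i j => ∫ ω, X ω i j ∂μ

/-- `X₁, …, X_N` are independent positive semidefinite random matrices with `‖X_k‖ ≤ L_k` and
`‖𝔼 X_k‖ = α_k L_k`; the norm is the operator norm for the Euclidean norm. -/
structure IsAdmissibleFamily {𝕜 : Type*} [RCLike 𝕜] {n N : ℕ} (L α : Fin N → ℝ)
    {Ω : Type*} [MeasurableSpace Ω] (μ : MeasureTheory.Measure Ω)
    (X : Fin N → Ω → Matrix (Fin n) (Fin n) 𝕜) : Prop where
  measurable : ∀ k, Measurable (X k)
  indep : ProbabilityTheory.iIndepFun X μ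
  posSemidef : ∀ k, ∀ᵐ ω ∂μ, (X k ω).PosSemidef
  norm_le : ∀ k, ∀ᵐ ω ∂μ, ‖X k ω‖ ≤ L k
  norm_expectation : ∀ k, ‖matrixExpectation μ (X k)‖ = α k * L k

/-- `Z₁, …, Z_N` are independent random elements with `ℙ(Z_k = a_k) = α_k` and
`ℙ(Z_k = 0) = 1 - α_k`. -/
structure IsTwoPointFamily {E : Type*} [MeasurableSpace E] [Zero E] {N : ℕ}
    (a : Fin N → E) (α : Fin N → ℝ) {Ω : Type*} [MeasurableSpace Ω]
    (μ : MeasureTheory.Measure Ω) (Z : Fin N → Ω → E) : Prop where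
  measurable : ∀ k, Measurable (Z k)
  indep : ProbabilityTheory.iIndepFun Z μ
  prob_eq : ∀ k, μ.real {ω | Z k ω = a k} = α k
  prob_zero : ∀ k, μ.real {ω | Z k ω = 0} = 1 - α k

/-- `𝔼 tr (∑ₖ X_k)^p`. For positive semidefinite `X_k` the trace is real, so taking its real part
only changes its type. -/
noncomputable def traceMoment {𝕜 : Type*} [RCLike 𝕜] {n N : ℕ} (p : ℕ) {Ω : Type*}
    [MeasurableSpace Ω] (μ : MeasureTheory.Measure Ω)
    (X : Fin N → Ω → Matrix (Fin n) (Fin n) 𝕜) : ℝ :=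
  ∫ ω, RCLike.re (((∑ k, X k ω) ^ p).trace) ∂μ

/-- The values of `𝔼 tr (∑ₖ X_k)^p` over all admissible families, on all probability spaces. -/
def admissibleTraceMoments (𝕜 : Type w) [RCLike 𝕜] (n p : ℕ) {N : ℕ} (L α : Fin N → ℝ) :
    Set ℝ :=
  {t | ∃ (Ω : Type u) (_ : MeasurableSpace Ω) (μ : MeasureTheory.Measure Ω)
    (X : Fin N → Ω → Matrix (Fin n) (Fin n) 𝕜), MeasureTheory.IsProbabilityMeasure μ ∧
      IsAdmissibleFamily L α μ X ∧ t = traceMoment p μ X}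

/-
Let `0 ≤ X ≤ L` and `A ≥ 0`. Chebyshev's sum inequality for the eigenvalues of `C ≥ 0` gives
`tr (X Cⁱ X Cʲ) ≤ tr (X² Cⁱ⁺ʲ)`, so `tr (X (A + t (L - X))^q)` is nondecreasing in `t ≥ 0`. With
`A + s X` in place of `A` and `t = s`, this makes `tr (X (A + s L)^p) - L tr ((A + s X)^p)`
nondecreasing in `s ≥ 0`, so `L (tr (A + X)^p - tr A^p) ≤ tr (X ((A + L)^p - A^p))`. The right side
is linear in `X`, and its expectation is at most `‖𝔼 X‖ (tr (A + L)^p - tr A^p)`. Hence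
`𝔼 tr (A + X)^p ≤ 𝔼 tr (A + Z)^p` for the two-point variable `Z` attached to `X`. As this holds for
every `A ≥ 0`, the independent summands of `∑ₖ X_k` can be replaced one at a time.
-/

open MeasureTheory ProbabilityTheory

section TraceInequalities

open Matrix
open scoped MatrixOrder

variable {𝕜 : Type*} [RCLike 𝕜] {ι : Type*} [Fintype ι]

theorem sum_mul_le_sum_mul_of_monovary {w : ι → ι → ℝ} (hw : ∀ k l, 0 ≤ w k l)
    (hsymm : ∀ k l, w k l = w l k) {a b : ι → ℝ} (hab : Monovary a b) :
    ∑ k, ∑ l, w k l * (a l * b k) ≤ ∑ k, ∑ l, w k l * (a k * b k) := by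
  have hswap (f : ι → ι → ℝ) : ∑ k, ∑ l, w k l * f k l = ∑ k, ∑ l, w k l * f l k := by
    rw [Finset.sum_comm]
    simp only [hsymm]
  have hnonneg : 0 ≤ ∑ k, ∑ l, w k l * ((a k - a l) * (b k - b l)) :=
    Finset.sum_nonneg fun k _ => Finset.sum_nonneg fun l _ =>
      mul_nonneg (hw k l) (hab.sub_mul_sub_nonneg l k)
  have hexpand : ∑ k, ∑ l, w k l * ((a k - a l) * (b k - b l)) =
      (∑ k, ∑ l, w k l * (a k * b k) + ∑ k, ∑ l, w k l * (a l * b l)) -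
        (∑ k, ∑ l, w k l * (a l * b k) + ∑ k, ∑ l, w k l * (a k * b l)) := by
    simp only [← Finset.sum_add_distrib, ← Finset.sum_sub_distrib]
    exact Finset.sum_congr rfl fun k _ => Finset.sum_congr rfl fun l _ => by ring
  have hsame := hswap fun k _ => a k * b k
  have hcross := hswap fun k l => a k * b l
  linarith

theorem le_of_hasDerivAt_nonneg {f f' : ℝ → ℝ} {a b : ℝ} (hf : ∀ s, HasDerivAt f (f' s) s)
    (hf' : ∀ s, a ≤ s → 0 ≤ f' s) (hab : a ≤ b) : f a ≤ f b :=
  monotoneOn_of_hasDerivWithinAt_nonneg (convex_Ici a)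
    (fun s _ => (hf s).continuousAt.continuousWithinAt) (fun s _ => (hf s).hasDerivWithinAt)
    (fun s hs => hf' s (interior_subset hs)) Set.self_mem_Ici hab hab

/-- The real part of the trace, as a continuous real-linear functional. On Hermitian matrices it
is the trace. -/
noncomputable def reTrace : Matrix ι ι 𝕜 →L[ℝ] ℝ :=
  RCLike.reCLM ∘L (traceLinearMap ι ℝ 𝕜).toContinuousLinearMap

theorem reTrace_apply (A : Matrix ι ι 𝕜) : reTrace A = RCLike.re A.trace := rfl

theorem reTrace_mul_comm (A B : Matrix ι ι 𝕜) : reTrace (A * B) = reTrace (B * A) := by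
  rw [reTrace_apply, trace_mul_comm, ← reTrace_apply]

theorem reTrace_nonneg {A : Matrix ι ι 𝕜} (hA : 0 ≤ A) : 0 ≤ reTrace A :=
  (RCLike.nonneg_iff.1 hA.posSemidef.trace_nonneg).1

theorem reTrace_mul_nonneg {A B : Matrix ι ι 𝕜} (hA : 0 ≤ A) (hB : 0 ≤ B) :
    0 ≤ reTrace (A * B) := by
  classical
  obtain ⟨C, rfl⟩ := CStarAlgebra.nonneg_iff_eq_star_mul_self.1 hB
  rw [← mul_assoc, reTrace_mul_comm, ← mul_assoc]
  exact reTrace_nonneg (star_right_conjugate_nonneg hA C)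

variable [DecidableEq ι]

noncomputable instance matrixNormedAlgebraReal : NormedAlgebra ℝ (Matrix ι ι 𝕜) where
  norm_smul_le r A := by
    rw [RCLike.real_smul_eq_coe_smul (K := 𝕜) r A, norm_smul, RCLike.norm_ofReal, Real.norm_eq_abs]

theorem matrix_le_norm_smul_one {A : Matrix ι ι 𝕜} (hA : A.IsHermitian) : A ≤ ‖A‖ • 1 := by
  cases isEmpty_or_nonempty ι
  · exact (Subsingleton.elim _ _).le
  rw [← Algebra.algebraMap_eq_smul_one]
  exact le_algebraMap_of_spectrum_le
    (fun x hx => (le_abs_self x).trans (spectrum.norm_le_norm_of_mem hx)) hA.isSelfAdjoint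

theorem reTrace_mul_le {A B : Matrix ι ι 𝕜} (hA : A.IsHermitian) (hB : 0 ≤ B) :
    reTrace (A * B) ≤ ‖A‖ * reTrace B := by
  have h := reTrace_mul_nonneg (sub_nonneg.2 (matrix_le_norm_smul_one hA)) hB
  simpa [sub_mul] using h

theorem matrix_pow_nonneg {A : Matrix ι ι 𝕜} (hA : 0 ≤ A) (q : ℕ) : 0 ≤ A ^ q :=
  (hA.posSemidef.pow q).nonneg

theorem matrix_pow_le_add_smul_one_pow {A : Matrix ι ι 𝕜} (hA : 0 ≤ A) {L : ℝ} (hL : 0 ≤ L)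
    (p : ℕ) : A ^ p ≤ (A + L • 1) ^ p := by
  have hL1 : (0 : Matrix ι ι 𝕜) ≤ L • 1 := smul_nonneg hL zero_le_one
  have hcomm : Commute (A + L • 1) A := (Commute.refl A).add_left ((Commute.one_left A).smul_left L)
  rw [← sub_nonneg, ← hcomm.mul_geom_sum₂, add_sub_cancel_left, smul_one_mul]
  exact smul_nonneg hL <| Finset.sum_nonneg fun i _ => (hcomm.pow_pow i _).mul_nonneg
    (matrix_pow_nonneg (add_nonneg hA hL1) i) (matrix_pow_nonneg hA _)

theorem reTrace_mul_diagonal_mul_diagonal {Y : Matrix ι ι 𝕜} (hY : Y.IsHermitian) (a b : ι → ℝ) :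
    reTrace (Y * diagonal (fun k => (a k : 𝕜)) * (Y * diagonal fun k => (b k : 𝕜))) =
      ∑ k, ∑ l, ‖Y k l‖ ^ 2 * (a l * b k) := by
  have hnorm (k l : ι) : Y k l * Y l k = ((‖Y k l‖ ^ 2 : ℝ) : 𝕜) := by
    rw [← hY.apply l k, RCLike.star_def, RCLike.mul_conj, RCLike.ofReal_pow]
  simp only [reTrace_apply, trace, diag_apply, mul_apply (M := Y * _), mul_diagonal, map_sum]
  refine Finset.sum_congr rfl fun k _ => Finset.sum_congr rfl fun l _ => ?_
  rw [mul_mul_mul_comm, hnorm, ← RCLike.ofReal_mul, ← RCLike.ofReal_mul, RCLike.ofReal_re]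

theorem reTrace_mul_diagonal_mul_diagonal_le {Y : Matrix ι ι 𝕜} (hY : Y.IsHermitian)
    {a b : ι → ℝ} (hab : Monovary a b) :
    reTrace (Y * diagonal (fun k => (a k : 𝕜)) * (Y * diagonal fun k => (b k : 𝕜))) ≤
      reTrace (Y * (Y * (diagonal (fun k => (a k : 𝕜)) * diagonal fun k => (b k : 𝕜)))) := by
  have hsymm (k l : ι) : ‖Y k l‖ ^ 2 = ‖Y l k‖ ^ 2 := by rw [← hY.apply, norm_star]
  have h := reTrace_mul_diagonal_mul_diagonal hY 1 (a * b)
  simp only [Pi.one_apply, RCLike.ofReal_one, diagonal_one, mul_one, Pi.mul_apply, one_mul,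
    RCLike.ofReal_mul] at h
  rw [diagonal_mul_diagonal, h, reTrace_mul_diagonal_mul_diagonal hY]
  exact sum_mul_le_sum_mul_of_monovary (fun k l => sq_nonneg _) hsymm hab

theorem reTrace_mul_pow_mul_pow_le {X C : Matrix ι ι 𝕜} (hX : X.IsHermitian) (hC : 0 ≤ C)
    (i j : ℕ) : reTrace (X * C ^ i * (X * C ^ j)) ≤ reTrace (X * (X * C ^ (i + j))) := by
  have hCh := hC.posSemidef.isHermitian
  set d := hCh.eigenvalues
  set φ := Unitary.conjStarAlgAut 𝕜 (Matrix ι ι 𝕜) hCh.eigenvectorUnitary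
  have htrace (M : Matrix ι ι 𝕜) : reTrace (φ M) = reTrace M := by
    rw [Unitary.conjStarAlgAut_apply, reTrace_mul_comm, ← mul_assoc,
      Unitary.coe_star_mul_self, one_mul]
  have hpow (q : ℕ) : C ^ q = φ (diagonal fun k => ((d k ^ q : ℝ) : 𝕜)) := by
    conv_lhs => rw [hCh.spectral_theorem, ← map_pow, diagonal_pow]
    congr 2
    ext k
    simp [d]
  have hd : Monovary (fun k => d k ^ i) fun k => d k ^ j :=
    ((monovary_self d).pow_left₀ hC.posSemidef.eigenvalues_nonneg i).pow_right₀
      hC.posSemidef.eigenvalues_nonneg j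
  obtain ⟨Y, rfl⟩ : ∃ Y, φ Y = X := φ.surjective X
  have hY : Y.IsHermitian := φ.injective ((map_star φ Y).trans hX)
  rw [pow_add, hpow i, hpow j]
  simp only [← map_mul, htrace]
  exact reTrace_mul_diagonal_mul_diagonal_le hY hd

theorem reTrace_mul_pow_mul_smul_one_sub_mul_pow_nonneg {X C : Matrix ι ι 𝕜} (hX : 0 ≤ X)
    {L : ℝ} (hXL : X ≤ L • 1) (hC : 0 ≤ C) (i j : ℕ) :
    0 ≤ reTrace (X * (C ^ i * (L • 1 - X) * C ^ j)) := by
  have hcomm : Commute X (L • 1 - X) :=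
    ((Commute.one_right X).smul_right L).sub_right (Commute.refl X)
  calc 0 ≤ reTrace (X * (L • 1 - X) * C ^ (i + j)) :=
        reTrace_mul_nonneg (hcomm.mul_nonneg hX (sub_nonneg.2 hXL)) (matrix_pow_nonneg hC _)
    _ = L • reTrace (X * C ^ (i + j)) - reTrace (X * (X * C ^ (i + j))) := by
        rw [← map_smul, ← map_sub]
        simp [mul_sub, sub_mul, mul_assoc]
    _ ≤ L • reTrace (X * C ^ (i + j)) - reTrace (X * C ^ i * (X * C ^ j)) :=
        sub_le_sub_left (reTrace_mul_pow_mul_pow_le hX.posSemidef.isHermitian hC i j) _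
    _ = reTrace (X * (C ^ i * (L • 1 - X) * C ^ j)) := by
        rw [← map_smul, ← map_sub]
        simp [mul_sub, sub_mul, mul_assoc, pow_add]

theorem hasDerivAt_reTrace_mul_add_smul_pow (Y A B : Matrix ι ι 𝕜) (q : ℕ) (t : ℝ) :
    HasDerivAt (fun s : ℝ => reTrace (Y * (A + s • B) ^ q))
      (∑ i ∈ Finset.range q,
        reTrace (Y * ((A + t • B) ^ (q - 1 - i) * B * (A + t • B) ^ i))) t := by
  have hpath : HasDerivAt (fun s : ℝ => A + s • B) B t := by
    simpa using ((hasDerivAt_id t).smul_const B).const_add A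
  convert! reTrace.hasFDerivAt.comp_hasDerivAt t ((hpath.fun_pow' q).const_mul Y) using 1
  rw [Finset.mul_sum, map_sum]
  rfl

theorem reTrace_mul_pow_le_add_smul_sub {X A : Matrix ι ι 𝕜} (hX : 0 ≤ X) {L : ℝ}
    (hXL : X ≤ L • 1) (hA : 0 ≤ A) (q : ℕ) {t : ℝ} (ht : 0 ≤ t) :
    reTrace (X * A ^ q) ≤ reTrace (X * (A + t • (L • 1 - X)) ^ q) := by
  have h := le_of_hasDerivAt_nonneg (hasDerivAt_reTrace_mul_add_smul_pow X A (L • 1 - X) q)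
    (fun s hs => Finset.sum_nonneg fun i _ =>
      reTrace_mul_pow_mul_smul_one_sub_mul_pow_nonneg hX hXL
        (add_nonneg hA (smul_nonneg hs (sub_nonneg.2 hXL))) _ _) ht
  simpa only [zero_smul, add_zero] using h

theorem hasDerivAt_reTrace_add_smul_pow (A B : Matrix ι ι 𝕜) (p : ℕ) (t : ℝ) :
    HasDerivAt (fun s : ℝ => reTrace ((A + s • B) ^ p))
      (p * reTrace (B * (A + t • B) ^ (p - 1))) t := by
  have h := hasDerivAt_reTrace_mul_add_smul_pow 1 A B p t
  have hterm (i : ℕ) (hi : i ∈ Finset.range p) :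
      reTrace (1 * ((A + t • B) ^ (p - 1 - i) * B * (A + t • B) ^ i)) =
        reTrace (B * (A + t • B) ^ (p - 1)) := by
    rw [one_mul, mul_assoc, reTrace_mul_comm, mul_assoc, ← pow_add,
      Nat.add_sub_cancel' (by have := Finset.mem_range.1 hi; omega)]
  rw [Finset.sum_congr rfl hterm, Finset.sum_const, Finset.card_range, nsmul_eq_mul] at h
  simpa only [one_mul] using h

theorem hasDerivAt_reTrace_mul_add_smul_one_pow (Y A : Matrix ι ι 𝕜) (L : ℝ) (p : ℕ) (t : ℝ) :
    HasDerivAt (fun s : ℝ => reTrace (Y * (A + s • L • 1) ^ p))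
      (p * (L * reTrace (Y * (A + t • L • 1) ^ (p - 1)))) t := by
  convert hasDerivAt_reTrace_mul_add_smul_pow Y A (L • 1) p t using 1
  have hterm (i : ℕ) (hi : i ∈ Finset.range p) :
      reTrace (Y * ((A + t • L • 1) ^ (p - 1 - i) * (L • 1) * (A + t • L • 1) ^ i)) =
        L * reTrace (Y * (A + t • L • 1) ^ (p - 1)) := by
    rw [mul_smul_one, smul_mul_assoc, mul_smul_comm, map_smul, smul_eq_mul, ← pow_add,
      Nat.sub_add_cancel (by have := Finset.mem_range.1 hi; omega)]
  rw [Finset.sum_congr rfl hterm, Finset.sum_const, Finset.card_range, nsmul_eq_mul]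

theorem mul_reTrace_add_pow_sub_le {X A : Matrix ι ι 𝕜} (hX : 0 ≤ X) {L : ℝ} (hL : 0 ≤ L)
    (hXL : X ≤ L • 1) (hA : 0 ≤ A) (p : ℕ) :
    L * (reTrace ((A + X) ^ p) - reTrace (A ^ p)) ≤ reTrace (X * ((A + L • 1) ^ p - A ^ p)) := by
  have hderiv (s : ℝ) := (hasDerivAt_reTrace_mul_add_smul_one_pow X A L p s).sub
    ((hasDerivAt_reTrace_add_smul_pow A X p s).const_mul L)
  have h := le_of_hasDerivAt_nonneg hderiv (fun s hs => ?_) zero_le_one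
  · simp only [Pi.sub_apply, zero_smul, one_smul, add_zero] at h
    rw [mul_sub, mul_sub (X : Matrix ι ι 𝕜), map_sub]
    linarith
  · have hle := reTrace_mul_pow_le_add_smul_sub hX hXL (add_nonneg hA (smul_nonneg hs hX))
      (p - 1) hs
    rw [add_assoc, ← smul_add, add_sub_cancel] at hle
    rw [mul_left_comm, ← mul_sub, ← mul_sub]
    exact mul_nonneg (mod_cast hL) (mul_nonneg p.cast_nonneg (sub_nonneg.2 hle))

end TraceInequalities

section TwoPoint

variable {E : Type*} [MeasurableSpace E] [Zero E] {N : ℕ} {a : Fin N → E} {α : Fin N → ℝ}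
  {Ω : Type*} [MeasurableSpace Ω] {μ : Measure Ω} {Z : Fin N → Ω → E}

theorem IsTwoPointFamily.comp_injective {F : Type*} [MeasurableSpace F] [Zero F]
    (h : IsTwoPointFamily a α μ Z) {φ : E → F} (hφ : Measurable φ) (hinj : φ.Injective)
    (hφ0 : φ 0 = 0) : IsTwoPointFamily (fun k => φ (a k)) α μ fun k ω => φ (Z k ω) where
  measurable k := hφ.comp (h.measurable k)
  indep := h.indep.comp (fun _ => φ) fun _ => hφ
  prob_eq k := by simpa only [hinj.eq_iff] using h.prob_eq k
  prob_zero k := by simpa only [← hφ0, hinj.eq_iff] using h.prob_zero k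

variable [MeasurableSingletonClass E]

theorem IsTwoPointFamily.ae_eq_or_eq_zero [IsProbabilityMeasure μ] (h : IsTwoPointFamily a α μ Z)
    {k : Fin N} (ha : a k ≠ 0) : ∀ᵐ ω ∂μ, Z k ω = a k ∨ Z k ω = 0 := by
  have hmeas (x : E) : MeasurableSet {ω | Z k ω = x} := h.measurable k (measurableSet_singleton x)
  have hdisj : Disjoint {ω | Z k ω = a k} {ω | Z k ω = 0} :=
    Set.disjoint_left.2 fun ω hω hω' => ha (hω.symm.trans hω')
  have hunion : μ.real ({ω | Z k ω = a k} ∪ {ω | Z k ω = 0}) = 1 := by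
    rw [measureReal_union hdisj (hmeas 0), h.prob_eq, h.prob_zero, add_sub_cancel]
  refine (mem_ae_iff_prob_eq_one ((hmeas (a k)).union (hmeas 0))).2 ?_
  rw [← ofReal_measureReal, hunion, ENNReal.ofReal_one]

theorem IsTwoPointFamily.integral_comp [IsProbabilityMeasure μ] {G : Type*} [NormedAddCommGroup G]
    [NormedSpace ℝ G] [CompleteSpace G] (h : IsTwoPointFamily a α μ Z) {k : Fin N} (ha : a k ≠ 0)
    (g : E → G) : ∫ ω, g (Z k ω) ∂μ = α k • g (a k) + (1 - α k) • g 0 := by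
  have hmeas (x : E) : MeasurableSet {ω | Z k ω = x} := h.measurable k (measurableSet_singleton x)
  have hae : (fun ω => g (Z k ω)) =ᵐ[μ] fun ω =>
      {ω | Z k ω = a k}.indicator (fun _ => g (a k)) ω +
        {ω | Z k ω = 0}.indicator (fun _ => g 0) ω := by
    filter_upwards [h.ae_eq_or_eq_zero ha] with ω hω
    rcases hω with hω | hω
    · simp [hω, ha]
    · simp [hω, ha.symm]
  rw [integral_congr_ae hae, integral_add ((integrable_const _).indicator (hmeas _))
    ((integrable_const _).indicator (hmeas 0)), integral_indicator_const _ (hmeas _),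
    integral_indicator_const _ (hmeas 0), h.prob_eq, h.prob_zero]

theorem exists_isTwoPointFamily (ha : ∀ k, a k ≠ 0) (hα : ∀ k, α k ∈ Set.Icc (0 : ℝ) 1) :
    ∃ (Ω : Type v) (_ : MeasurableSpace Ω) (μ : Measure Ω) (Z : Fin N → Ω → E),
      IsProbabilityMeasure μ ∧ IsTwoPointFamily a α μ Z := by
  obtain ⟨Ω, mΩ, μ, B, hB, hlaw, hindep, hμ⟩ := exists_hasLaw_indepFun
    (fun _ : Fin N => ULift.{v} Bool) fun k => bernoulliMeasure ⟨true⟩ ⟨false⟩ ⟨α k, hα k⟩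
  let φ (k : Fin N) (b : ULift.{v} Bool) : E := if b.down then a k else 0
  have hφ (k : Fin N) : Measurable (φ k) :=
    (measurable_of_finite fun c : Bool => if c then a k else 0).comp measurable_down
  have hmeas (k : Fin N) (x : E) : MeasurableSet {b | φ k b = x} :=
    hφ k (measurableSet_singleton x)
  refine ⟨Ω, mΩ, μ, fun k ω => φ k (B k ω), hμ, fun k => (hφ k).comp (hB k), hindep.comp _ hφ,
    fun k => ?_, fun k => ?_⟩
  · rw [(hlaw k).measureReal_eq (hmeas k (a k)), bernoulliMeasure_real_apply_of_mem_of_notMem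
      _ (hmeas k (a k)) (by simp [φ]) (by simp [φ, (ha k).symm])]
  · rw [(hlaw k).measureReal_eq (hmeas k 0), bernoulliMeasure_real_apply_of_notMem_of_mem
      _ (hmeas k 0) (by simp [φ, ha k]) (by simp [φ])]

end TwoPoint

section ConvolutionOrder

open scoped ENNReal

theorem integrable_comp_of_memLp_top {E : Type*} [NormedAddCommGroup E] [ProperSpace E] {Ω : Type*}
    [MeasurableSpace Ω] {μ : Measure Ω} [IsFiniteMeasure μ] {Y : Ω → E} (hY : MemLp Y ∞ μ)
    {g : E → ℝ} (hg : Continuous g) : Integrable (fun ω => g (Y ω)) μ := by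
  obtain ⟨C, hC⟩ := (isCompact_closedBall (0 : E)
    (eLpNormEssSup Y μ).toReal).exists_bound_of_continuousOn hg.continuousOn
  refine Integrable.of_bound (hg.comp_aestronglyMeasurable hY.aestronglyMeasurable) C ?_
  have hfin : eLpNormEssSup Y μ ≠ ∞ := by simpa using hY.eLpNorm_ne_top
  filter_upwards [ae_le_eLpNormEssSup (f := Y) (μ := μ)] with ω hω
  refine hC _ (mem_closedBall_zero_iff.2 ?_)
  simpa using ENNReal.toReal_mono hfin hω

variable {E : Type*} [NormedAddCommGroup E] [MeasurableSpace E]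

/-- A stochastic order: the integral of every translate `g (A + ·)` with `A ∈ D` against `μ` is at
most the one against `ν`. The translates are what makes the order compatible with convolution. -/
def TranslateIntegralLE (D : AddSubmonoid E) (g : E → ℝ) (μ ν : Measure E) : Prop :=
  ∀ A ∈ D, ∫ x, g (A + x) ∂μ ≤ ∫ x, g (A + x) ∂ν

variable [BorelSpace E]

theorem memLp_id_conv [SecondCountableTopology E] {p : ℝ≥0∞} {μ ν : Measure E}
    [IsFiniteMeasure μ] [IsFiniteMeasure ν] (hμ : MemLp id p μ) (hν : MemLp id p ν) :
    MemLp id p (μ ∗ ν) :=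
  (memLp_map_measure_iff aestronglyMeasurable_id measurable_add.aemeasurable).2
    ((hμ.comp_fst ν).add (hν.comp_snd μ))

variable [ProperSpace E] {D : AddSubmonoid E} {g : E → ℝ} {μ ν μ' ν' : Measure E}
  [IsFiniteMeasure μ] [IsFiniteMeasure ν] [IsFiniteMeasure μ'] [IsFiniteMeasure ν']

theorem TranslateIntegralLE.conv_left (h : TranslateIntegralLE D g μ μ') (hg : Continuous g)
    (hμ : MemLp id ∞ μ) (hμ' : MemLp id ∞ μ') (hν : MemLp id ∞ ν) (hνD : ∀ᵐ y ∂ν, y ∈ D) :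
    TranslateIntegralLE D g (ν ∗ μ) (ν ∗ μ') := by
  intro A hA
  have hgA : Continuous fun x => g (A + x) := hg.comp (continuous_const.add continuous_id)
  have hprod {ρ : Measure E} [IsFiniteMeasure ρ] (hρ : MemLp id ∞ ρ) :
      Integrable (fun y => ∫ x, g (A + (y + x)) ∂ρ) ν :=
    (integrable_comp_of_memLp_top ((hν.comp_fst ρ).add (hρ.comp_snd ν)) hgA).integral_prod_left
  have hconv {ρ : Measure E} [IsFiniteMeasure ρ] (hρ : MemLp id ∞ ρ) :
      ∫ x, g (A + x) ∂(ν ∗ ρ) = ∫ y, ∫ x, g (A + (y + x)) ∂ρ ∂ν :=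
    integral_conv (integrable_comp_of_memLp_top (memLp_id_conv hν hρ) hgA)
  rw [hconv hμ, hconv hμ']
  refine integral_mono_ae (hprod hμ) (hprod hμ') ?_
  filter_upwards [hνD] with y hy
  simpa only [add_assoc] using h (A + y) (D.add_mem hA hy)

theorem TranslateIntegralLE.conv (hle : TranslateIntegralLE D g μ μ')
    (hle' : TranslateIntegralLE D g ν ν') (hg : Continuous g) (hμ : MemLp id ∞ μ)
    (hμ' : MemLp id ∞ μ') (hν : MemLp id ∞ ν) (hν' : MemLp id ∞ ν') (hνD : ∀ᵐ y ∂ν, y ∈ D)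
    (hμ'D : ∀ᵐ x ∂μ', x ∈ D) : TranslateIntegralLE D g (μ ∗ ν) (μ' ∗ ν') := by
  intro A hA
  calc ∫ x, g (A + x) ∂(μ ∗ ν) = ∫ x, g (A + x) ∂(ν ∗ μ) := by rw [Measure.conv_comm]
    _ ≤ ∫ x, g (A + x) ∂(ν ∗ μ') := hle.conv_left hg hμ hμ' hν hνD A hA
    _ = ∫ x, g (A + x) ∂(μ' ∗ ν) := by rw [Measure.conv_comm]
    _ ≤ ∫ x, g (A + x) ∂(μ' ∗ ν') := hle'.conv_left hg hν hν' hμ' hμ'D A hA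

theorem translateIntegralLE_map_sum {ι Ω Ω' : Type*} [MeasurableSpace Ω] [MeasurableSpace Ω']
    {P : Measure Ω} {Q : Measure Ω'} [IsProbabilityMeasure P] [IsProbabilityMeasure Q]
    {X : ι → Ω → E} {Z : ι → Ω' → E} (hg : Continuous g) (hD : MeasurableSet (D : Set E))
    (hX : ∀ k, MemLp (X k) ∞ P) (hZ : ∀ k, MemLp (Z k) ∞ Q)
    (hXindep : iIndepFun X P) (hZindep : iIndepFun Z Q)
    (hXD : ∀ k, ∀ᵐ ω ∂P, X k ω ∈ D) (hZD : ∀ k, ∀ᵐ ω ∂Q, Z k ω ∈ D)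
    (hXZ : ∀ k, TranslateIntegralLE D g (P.map (X k)) (Q.map (Z k))) (s : Finset ι) :
    TranslateIntegralLE D g (P.map (∑ k ∈ s, X k)) (Q.map (∑ k ∈ s, Z k)) := by
  classical
  have hXm (k : ι) : AEMeasurable (X k) P := (hX k).aestronglyMeasurable.aemeasurable
  have hZm (k : ι) : AEMeasurable (Z k) Q := (hZ k).aestronglyMeasurable.aemeasurable
  induction s using Finset.induction_on with
  | empty =>
    intro A _
    simp [Pi.zero_def, Measure.map_const]
  | insert k s hk ih =>
    have hXs := Finset.aemeasurable_sum s fun l _ => hXm l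
    have hZs := Finset.aemeasurable_sum s fun l _ => hZm l
    have hXsD : ∀ᵐ ω ∂P, (∑ l ∈ s, X l) ω ∈ D := by
      filter_upwards [(Finset.eventually_all s).2 fun l _ => hXD l] with ω hω
      simpa only [Finset.sum_apply] using D.sum_mem hω
    rw [Finset.sum_insert hk, Finset.sum_insert hk,
      (hXindep.indepFun_finsetSum_of_notMem₀ hXm hk).symm.map_add_eq_map_conv_map₀ (hXm k) hXs,
      (hZindep.indepFun_finsetSum_of_notMem₀ hZm hk).symm.map_add_eq_map_conv_map₀ (hZm k) hZs]
    exact (hXZ k).conv ih hg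
      ((memLp_map_measure_iff aestronglyMeasurable_id (hXm k)).2 (hX k))
      ((memLp_map_measure_iff aestronglyMeasurable_id (hZm k)).2 (hZ k))
      ((memLp_map_measure_iff aestronglyMeasurable_id hXs).2 (memLp_finsetSum' s fun l _ => hX l))
      ((memLp_map_measure_iff aestronglyMeasurable_id hZs).2 (memLp_finsetSum' s fun l _ => hZ l))
      ((ae_map_iff hXs hD).2 hXsD) ((ae_map_iff (hZm k) hD).2 (hZD k))

end ConvolutionOrder

section RandomMatrix

open Matrix

open scoped MatrixOrder ENNReal

variable {𝕜 : Type*} [RCLike 𝕜]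

section BoundedRandomMatrix

variable {ι : Type*}

instance matrixBorelSpace [Countable ι] : BorelSpace (Matrix ι ι 𝕜) :=
  inferInstanceAs (BorelSpace (ι → ι → 𝕜))

theorem isClosed_Ici_zero_matrix [Finite ι] : IsClosed (Set.Ici (0 : Matrix ι ι 𝕜)) := by
  cases nonempty_fintype ι
  have hclosed (x : ι → 𝕜) : IsClosed {A : Matrix ι ι 𝕜 | 0 ≤ star x ⬝ᵥ A *ᵥ x} :=
    isClosed_le continuous_const (by fun_prop)
  convert (isClosed_eq continuous_id.matrix_conjTranspose continuous_id).inter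
    (isClosed_iInter hclosed) using 1
  ext A
  simp [nonneg_iff_posSemidef, posSemidef_iff_dotProduct_mulVec, IsHermitian]

variable [Fintype ι] [DecidableEq ι]

instance matrixProperSpace : ProperSpace (Matrix ι ι 𝕜) :=
  FiniteDimensional.proper 𝕜 _

variable {Ω : Type*} [MeasurableSpace Ω] {μ : Measure Ω} [IsProbabilityMeasure μ]
  {X : Ω → Matrix ι ι 𝕜}

theorem mul_integral_reTrace_add_pow_sub_le (hX : AEStronglyMeasurable X μ)
    (hpos : ∀ᵐ ω ∂μ, 0 ≤ X ω) {L : ℝ} (hL : 0 ≤ L) (hnorm : ∀ᵐ ω ∂μ, ‖X ω‖ ≤ L)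
    {A : Matrix ι ι 𝕜} (hA : 0 ≤ A) (p : ℕ) :
    L * (∫ ω, reTrace ((A + X ω) ^ p) ∂μ - reTrace (A ^ p)) ≤
      ‖∫ ω, X ω ∂μ‖ * (reTrace ((A + L • 1) ^ p) - reTrace (A ^ p)) := by
  set B := (A + L • 1) ^ p - A ^ p with hB
  have hbdd : MemLp X ∞ μ := memLp_top_of_bound hX L hnorm
  have hmoment : Integrable (fun ω => reTrace ((A + X ω) ^ p)) μ :=
    integrable_comp_of_memLp_top hbdd (g := fun M => reTrace ((A + M) ^ p)) (by fun_prop)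
  have hlin : Integrable (fun ω => reTrace (X ω * B)) μ :=
    integrable_comp_of_memLp_top hbdd (g := fun M => reTrace (M * B)) (by fun_prop)
  have hherm : (∫ ω, X ω ∂μ).IsHermitian :=
    ((convex_Ici 0).integral_mem isClosed_Ici_zero_matrix hpos (hbdd.integrable le_top) :
      0 ≤ ∫ ω, X ω ∂μ).posSemidef.isHermitian
  calc L * (∫ ω, reTrace ((A + X ω) ^ p) ∂μ - reTrace (A ^ p))
      = ∫ ω, L * (reTrace ((A + X ω) ^ p) - reTrace (A ^ p)) ∂μ := by
        rw [integral_const_mul, integral_sub hmoment (integrable_const _), integral_const,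
          probReal_univ, one_smul]
    _ ≤ ∫ ω, reTrace (X ω * B) ∂μ := by
        refine integral_mono_ae ((hmoment.sub (integrable_const _)).const_mul L) hlin ?_
        filter_upwards [hpos, hnorm] with ω hω hωL
        have hωL1 : X ω ≤ L • 1 := (matrix_le_norm_smul_one hω.posSemidef.isHermitian).trans
          (smul_le_smul_of_nonneg_right hωL zero_le_one)
        exact mul_reTrace_add_pow_sub_le hω hL hωL1 hA p
    _ = reTrace ((∫ ω, X ω ∂μ) * B) :=
        (reTrace.comp ((ContinuousLinearMap.mul ℝ (Matrix ι ι 𝕜)).flip B)).integral_comp_comm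
          (hbdd.integrable le_top)
    _ ≤ ‖∫ ω, X ω ∂μ‖ * reTrace B :=
        reTrace_mul_le hherm (sub_nonneg.2 (matrix_pow_le_add_smul_one_pow hA hL p))
    _ = ‖∫ ω, X ω ∂μ‖ * (reTrace ((A + L • 1) ^ p) - reTrace (A ^ p)) := by rw [hB, map_sub]

end BoundedRandomMatrix

section Families

variable {n N : ℕ} {L α : Fin N → ℝ} {Ω : Type*} [MeasurableSpace Ω] {μ : Measure Ω}

theorem matrixExpectation_eq_integral {X : Ω → Matrix (Fin n) (Fin n) 𝕜} (hX : Integrable X μ) :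
    matrixExpectation μ X = ∫ ω, X ω ∂μ := by
  ext i j
  exact (LinearMap.toContinuousLinearMap (entryLinearMap ℝ 𝕜 i j)).integral_comp_comm hX

theorem smul_one_matrix_ne_zero (hn : 1 ≤ n) {c : ℝ} (hc : c ≠ 0) :
    (c : 𝕜) • (1 : Matrix (Fin n) (Fin n) 𝕜) ≠ 0 := by
  have : NeZero n := ⟨by omega⟩
  exact smul_ne_zero (RCLike.ofReal_ne_zero.2 hc) one_ne_zero

theorem norm_smul_one_matrix (hn : 1 ≤ n) (c : ℝ) :
    ‖(c : 𝕜) • (1 : Matrix (Fin n) (Fin n) 𝕜)‖ = |c| := by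
  have : NeZero n := ⟨by omega⟩
  rw [norm_smul, CStarRing.norm_one, mul_one, RCLike.norm_ofReal]

theorem IsTwoPointFamily.smul_one_matrix {f : Fin N → Ω → ℝ} (hf : IsTwoPointFamily L α μ f)
    (hn : 1 ≤ n) : IsTwoPointFamily (fun k => (L k : 𝕜) • (1 : Matrix (Fin n) (Fin n) 𝕜)) α μ
      fun k ω => (f k ω : 𝕜) • 1 := by
  have : NeZero n := ⟨by omega⟩
  have hcont : Continuous fun c : ℝ => (c : 𝕜) • (1 : Matrix (Fin n) (Fin n) 𝕜) := by fun_prop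
  exact hf.comp_injective hcont.measurable
    ((smul_left_injective 𝕜 one_ne_zero).comp RCLike.ofReal_injective) (by simp)

theorem traceMoment_smul_one (f : Fin N → Ω → ℝ) (p : ℕ) :
    traceMoment p μ (fun k ω => (f k ω : 𝕜) • (1 : Matrix (Fin n) (Fin n) 𝕜)) =
      (∫ ω, (∑ k, f k ω) ^ p ∂μ) * n := by
  have htrace (c : ℝ) :
      RCLike.re (((c : 𝕜) • (1 : Matrix (Fin n) (Fin n) 𝕜)) ^ p).trace = c ^ p * n := by
    rw [smul_pow, one_pow, trace_smul, trace_one, smul_eq_mul, ← RCLike.ofReal_pow,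
      RCLike.re_ofReal_mul]
    simp
  simp only [traceMoment, ← Finset.sum_smul, ← RCLike.ofReal_sum, htrace, integral_mul_const]

theorem IsAdmissibleFamily.memLp_top {X : Fin N → Ω → Matrix (Fin n) (Fin n) 𝕜}
    (hX : IsAdmissibleFamily L α μ X) (k : Fin N) : MemLp (X k) ∞ μ :=
  memLp_top_of_bound (hX.measurable k).aestronglyMeasurable (L k) (hX.norm_le k)

theorem IsAdmissibleFamily.ae_nonneg {X : Fin N → Ω → Matrix (Fin n) (Fin n) 𝕜}
    (hX : IsAdmissibleFamily L α μ X) (k : Fin N) : ∀ᵐ ω ∂μ, 0 ≤ X k ω := by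
  filter_upwards [hX.posSemidef k] with ω hω using hω.nonneg

theorem traceMoment_eq_integral_map {X : Fin N → Ω → Matrix (Fin n) (Fin n) 𝕜}
    (hX : ∀ k, Measurable (X k)) (p : ℕ) :
    traceMoment p μ X = ∫ M, reTrace (M ^ p) ∂(μ.map (∑ k, X k)) := by
  have hcont : Continuous fun M : Matrix (Fin n) (Fin n) 𝕜 => reTrace (M ^ p) := by fun_prop
  have hsum : AEMeasurable (∑ k, X k) μ :=
    Finset.aemeasurable_sum _ fun k _ => (hX k).aemeasurable
  rw [integral_map hsum hcont.aestronglyMeasurable]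
  simp only [Finset.sum_apply]
  rfl

variable [IsProbabilityMeasure μ]

theorem IsTwoPointFamily.isAdmissibleFamily {Z : Fin N → Ω → Matrix (Fin n) (Fin n) 𝕜}
    (hZ : IsTwoPointFamily (fun k => (L k : 𝕜) • 1) α μ Z) (hn : 1 ≤ n) (hL : ∀ k, 0 < L k) :
    IsAdmissibleFamily L α μ Z := by
  have hval (k : Fin N) : ∀ᵐ ω ∂μ, Z k ω = (L k : 𝕜) • 1 ∨ Z k ω = 0 :=
    hZ.ae_eq_or_eq_zero (smul_one_matrix_ne_zero hn (hL k).ne')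
  refine ⟨hZ.measurable, hZ.indep, fun k => ?_, fun k => ?_, fun k => ?_⟩
  · filter_upwards [hval k] with ω hω
    rcases hω with hω | hω <;> rw [hω]
    · exact PosSemidef.one.smul (by simpa using (hL k).le)
    · exact PosSemidef.zero
  · filter_upwards [hval k] with ω hω
    rcases hω with hω | hω <;> rw [hω]
    · rw [norm_smul_one_matrix hn, abs_of_pos (hL k)]
    · simpa using (hL k).le
  · have hmean : matrixExpectation μ (Z k) = ((α k * L k : ℝ) : 𝕜) • 1 := by
      ext i j
      refine (hZ.integral_comp (smul_one_matrix_ne_zero hn (hL k).ne') fun M => M i j).trans ?_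
      simp [RCLike.real_smul_eq_coe_mul, mul_assoc]
    have hα : 0 ≤ α k := hZ.prob_eq k ▸ measureReal_nonneg
    rw [hmean, norm_smul_one_matrix hn, abs_of_nonneg (mul_nonneg hα (hL k).le)]

variable {Ω' : Type*} [MeasurableSpace Ω'] {ν : Measure Ω'} [IsProbabilityMeasure ν]
  {X : Fin N → Ω → Matrix (Fin n) (Fin n) 𝕜} {Z : Fin N → Ω' → Matrix (Fin n) (Fin n) 𝕜}

theorem IsAdmissibleFamily.translateIntegralLE (hX : IsAdmissibleFamily L α μ X)
    (hZ : IsTwoPointFamily (fun k => (L k : 𝕜) • 1) α ν Z) (hn : 1 ≤ n) (hL : ∀ k, 0 < L k)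
    (p : ℕ) (k : Fin N) :
    TranslateIntegralLE (AddSubmonoid.nonneg _) (fun M => reTrace (M ^ p)) (μ.map (X k))
      (ν.map (Z k)) := by
  intro A hA
  have hcont : Continuous fun M => reTrace ((A + M) ^ p) := by fun_prop
  have hbound := mul_integral_reTrace_add_pow_sub_le
    (hX.measurable k).aestronglyMeasurable (hX.ae_nonneg k) (hL k).le (hX.norm_le k) hA p
  rw [← matrixExpectation_eq_integral ((hX.memLp_top k).integrable le_top), hX.norm_expectation,
    mul_comm (α k), mul_assoc] at hbound
  have hle := le_of_mul_le_mul_left hbound (hL k)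
  rw [integral_map (hX.measurable k).aemeasurable hcont.aestronglyMeasurable,
    integral_map (hZ.measurable k).aemeasurable hcont.aestronglyMeasurable,
    hZ.integral_comp (smul_one_matrix_ne_zero hn (hL k).ne') fun M => reTrace ((A + M) ^ p),
    add_zero, ← RCLike.real_smul_eq_coe_smul (K := 𝕜), smul_eq_mul, smul_eq_mul]
  linarith

theorem IsAdmissibleFamily.traceMoment_le (hX : IsAdmissibleFamily L α μ X)
    (hZ : IsTwoPointFamily (fun k => (L k : 𝕜) • 1) α ν Z) (hn : 1 ≤ n) (hL : ∀ k, 0 < L k)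
    (p : ℕ) : traceMoment p μ X ≤ traceMoment p ν Z := by
  have hZ' := hZ.isAdmissibleFamily hn hL
  have hle := translateIntegralLE_map_sum (by fun_prop) isClosed_Ici_zero_matrix.measurableSet
    hX.memLp_top hZ'.memLp_top hX.indep hZ'.indep hX.ae_nonneg hZ'.ae_nonneg
    (hX.translateIntegralLE hZ hn hL p) Finset.univ 0 (zero_mem _)
  rw [traceMoment_eq_integral_map hX.measurable, traceMoment_eq_integral_map hZ.measurable]
  simpa only [zero_add] using hle

theorem IsTwoPointFamily.isGreatest_traceMoment {𝕜 : Type w} [RCLike 𝕜]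
    {Z : Fin N → Ω' → Matrix (Fin n) (Fin n) 𝕜}
    (hZ : IsTwoPointFamily (fun k => (L k : 𝕜) • 1) α ν Z) (hn : 1 ≤ n) (hL : ∀ k, 0 < L k)
    (p : ℕ) : IsGreatest (admissibleTraceMoments.{u, w} 𝕜 n p L α) (traceMoment p ν Z) := by
  constructor
  -- The space of `Z` need not lie in the universe `u`, so a two-point family in `u` is needed here.
  · have hα (k : Fin N) : α k ∈ Set.Icc (0 : ℝ) 1 :=
      hZ.prob_eq k ▸ ⟨measureReal_nonneg, measureReal_le_one⟩
    obtain ⟨Ω₀, mΩ₀, μ₀, Z₀, hμ₀, hZ₀⟩ := exists_isTwoPointFamily.{u}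
      (fun k => smul_one_matrix_ne_zero (𝕜 := 𝕜) hn (hL k).ne') hα
    have hadm := hZ.isAdmissibleFamily hn hL
    have hadm₀ := hZ₀.isAdmissibleFamily hn hL
    exact ⟨Ω₀, mΩ₀, μ₀, Z₀, hμ₀, hadm₀,
      (hadm.traceMoment_le hZ₀ hn hL p).antisymm (hadm₀.traceMoment_le hZ hn hL p)⟩
  · rintro t ⟨Ω₀, mΩ₀, μ₀, X, hμ₀, hX, rfl⟩
    exact hX.traceMoment_le hZ hn hL p

end Families

end RandomMatrix

theorem theorem1p1 (𝕜 : Type w) [RCLike 𝕜] (p n N : ℕ)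
    (hp : 1 ≤ p) (hn : 1 ≤ n) (hN : 1 ≤ N) (L α : Fin N → ℝ)
    (hL : ∀ k, 0 < L k) (hα : ∀ k, α k ∈ Set.Icc (0 : ℝ) 1) :
    -- the two-point families exist, both of matrices and of scalars
    (∃ (Ω : Type v) (_ : MeasurableSpace Ω) (μ : MeasureTheory.Measure Ω)
      (Z : Fin N → Ω → Matrix (Fin n) (Fin n) 𝕜), MeasureTheory.IsProbabilityMeasure μ ∧
        IsTwoPointFamily (fun k => (L k : 𝕜) • (1 : Matrix (Fin n) (Fin n) 𝕜)) α μ Z) ∧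
    (∃ (Ω : Type v) (_ : MeasurableSpace Ω) (μ : MeasureTheory.Measure Ω)
      (f : Fin N → Ω → ℝ), MeasureTheory.IsProbabilityMeasure μ ∧
        IsTwoPointFamily L α μ f) ∧
    -- every two-point family of matrices is admissible and attains the maximum
    (∀ (Ω : Type v) [MeasurableSpace Ω] (μ : MeasureTheory.Measure Ω)
      [MeasureTheory.IsProbabilityMeasure μ] (Z : Fin N → Ω → Matrix (Fin n) (Fin n) 𝕜),
      IsTwoPointFamily (fun k => (L k : 𝕜) • (1 : Matrix (Fin n) (Fin n) 𝕜)) α μ Z →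
        IsAdmissibleFamily L α μ Z ∧
        IsGreatest (admissibleTraceMoments.{u, w} 𝕜 n p L α) (traceMoment p μ Z)) ∧
    -- the maximum is `𝔼 (f₁ + ⋯ + f_N)^p` times `n`
    (∀ (Ω : Type v) [MeasurableSpace Ω] (μ : MeasureTheory.Measure Ω)
      [MeasureTheory.IsProbabilityMeasure μ] (f : Fin N → Ω → ℝ),
      IsTwoPointFamily L α μ f →
        IsGreatest (admissibleTraceMoments.{u, w} 𝕜 n p L α)
          ((∫ ω, (∑ k, f k ω) ^ p ∂μ) * n)) := by
  have hne (k : Fin N) : (L k : 𝕜) • (1 : Matrix (Fin n) (Fin n) 𝕜) ≠ 0 :=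
    smul_one_matrix_ne_zero hn (hL k).ne'
  refine ⟨exists_isTwoPointFamily hne hα, exists_isTwoPointFamily (fun k => (hL k).ne') hα,
    fun Ω _ μ _ Z hZ => ⟨hZ.isAdmissibleFamily hn hL, hZ.isGreatest_traceMoment hn hL p⟩,
    fun Ω _ μ _ f hf => ?_⟩
  rw [← traceMoment_smul_one (𝕜 := 𝕜)]
  exact (hf.smul_one_matrix hn).isGreatest_traceMoment hn hL p
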